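/- Let $p$ be a prime, $m\ge 1$, $q=p^m$ and $n=q^2+1$. Let $\lambda\in\mathbb{F}_{q^2}^*$ have multiplicative order $r$, and let $\delta\in\mathbb{F}_{q^4}$ be a primitive $rn$-th root of unity with $\delta^n=\lambda$. For a positive integer $s$ let $\mathcal{C}(1,s)\subseteq\mathbb{F}_{q^2}^n$ denote the $\lambda$-constacyclic code of length $n$ whose check polynomial is $g_1(x)g_s(x)$, where $g_i(x)$ is the minimal polynomial of $\delta^i$ over $\mathbb{F}_{q^2}$; that is, identifying $(c_0,\dots,c_{n-1})$ with $\sum_i c_ix^i$, the code is the ideal of $\mathbb{F}_{q^2}[x]/\langle x^n-\lambda\rangle$ generated by $(x^n-\lambda)/(g_1(x)g_s(x))$. Assume that either (i) $r\mid q+1$, $\nu_2(r)=\nu_2(q+1)$ and $\mathcal{C}=\mathcal{C}(1,q^2+q+1)$, or (ii) $r\mid q-1$, $\nu_2(r)=\nu_2(q-1)$ and $\mathcal{C}=\mathcal{C}(1,q^2-q+1)$, where $\nu_2$ is the 2-adic valuation. A linear code has locality $r_l$ if for every coordinate $i$ there are at most $r_l$ other coordinates such that the $i$-th symbol of every codeword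 is a function of its symbols at those coordinates. Let $k_{\mathrm{opt}}(N,d)$ denote the largest dimension of a linear code over $\mathbb{F}_{q^2}$ of length $N$ and minimum distance at least $d$ (the zero code being admitted, and the value being $0$ for $N\le 0$). Then the Euclidean dual $\mathcal{C}^\perp$ has length $n=q^2+1$, dimension $k=q^2-3$ and minimum distance $d$, where $d=4$ if $q>2$ and $d=5$ if $q=2$. The smallest integer $r_l$ such that $\mathcal{C}^\perp$ has locality $r_l$ is $r_l=q^2-q-1$. With these values $\mathcal{C}^\perp$ meets the Singleton-like bound and the Cadambe–Mazumdar bound with equality, $$d=n-k-\left\lceil \frac{k}{r_l}\right\rceil+2,\qquad k=\min_{t\in\mathbb{Z}_{\ge 0}}\bigl\{t\,r_l+k_{\mathrm{opt}}(n-t(r_l+1),d)\bigr\},$$ that is, $\mathcal{C}^\perp$ is a distance-optimal and dimension-optimal locally recoverable code. -/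

import Mathlib

noncomputable section

namespace LRCCode

open Polynomial

variable {F : Type*} [Field F]

/-- The map `(c₀, …, c_{n-1}) ↦ ∑ cᵢ xⁱ` from `Fⁿ` to `F[x] / ⟨xⁿ - lam⟩`. -/
def toQuotient (n : ℕ) (lam : F) : (Fin n → F) →ₗ[F] AdjoinRoot (X ^ n - C lam : F[X]) where
  toFun c := ∑ i : Fin n, c i • AdjoinRoot.root (X ^ n - C lam : F[X]) ^ (i : ℕ)
  map_add' c d := by simp [add_smul, Finset.sum_add_distrib]
  map_smul' a c := by simp [mul_smul, Finset.smul_sum]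

/-- The `lam`-constacyclic code of length `n` with generator polynomial `g`: the words whose
image lies in the ideal generated by `g` in `F[x] / ⟨xⁿ - lam⟩`. -/
def constacyclicCode (n : ℕ) (lam : F) (g : F[X]) : Submodule F (Fin n → F) :=
  ((Ideal.span {AdjoinRoot.mk (X ^ n - C lam : F[X]) g}).restrictScalars F).comap
    (toQuotient n lam)

/-- The `lam`-constacyclic code of length `n` with check polynomial `h` (a divisor of
`xⁿ - lam`): its generator polynomial is `(xⁿ - lam) / h`. -/
def codeOfCheck (n : ℕ) (lam : F) (h : F[X]) : Submodule F (Fin n → F) :=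
  constacyclicCode n lam ((X ^ n - C lam) / h)

/-- The constacyclic code `C(1, s)` of length `q² + 1`, whose check polynomial is the product of
the minimal polynomials over `F` of `δ` and of `δ ^ s`. -/
def codeC {K : Type*} [Field K] [Algebra F K] (q : ℕ) (lam : F) (δ : K) (s : ℕ) :
    Submodule F (Fin (q ^ 2 + 1) → F) :=
  codeOfCheck (q ^ 2 + 1) lam (minpoly F δ * minpoly F (δ ^ s))

/-- The (Euclidean) dual code. -/
def dual {n : ℕ} (D : Submodule F (Fin n → F)) : Submodule F (Fin n → F) where
  carrier := {x | ∀ c ∈ D, ∑ i, x i * c i = 0}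
  zero_mem' := by simp
  add_mem' hx hy c hc := by simp [add_mul, Finset.sum_add_distrib, hx c hc, hy c hc]
  smul_mem' a x hx c hc := by simp [mul_assoc, ← Finset.mul_sum, hx c hc]

/-- `D` has minimum Hamming distance `d`. -/
def HasMinDist [DecidableEq F] {n : ℕ} (D : Submodule F (Fin n → F)) (d : ℕ) : Prop :=
  IsLeast {w | ∃ x ∈ D, ∃ y ∈ D, x ≠ y ∧ hammingDist x y = w} d

/-- The `i`-th symbol has locality `s`: on `D` it is a function of `s` other symbols. -/
def SymbolHasLocality {n : ℕ} (D : Submodule F (Fin n → F)) (i : Fin n) (s : ℕ) : Prop :=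
  ∃ R : Finset (Fin n), i ∉ R ∧ R.card = s ∧
    ∃ f : (R → F) → F, ∀ x ∈ D, x i = f fun j => x j

/-- `D` has locality `r`: every symbol has locality at most `r`. -/
def HasLocality {n : ℕ} (D : Submodule F (Fin n → F)) (r : ℕ) : Prop :=
  ∀ i, ∃ s ≤ r, SymbolHasLocality D i s

/-- `D` is an `(n, k, d, |F|; r)`-LRC. -/
structure IsLRC [DecidableEq F] {n : ℕ} (D : Submodule F (Fin n → F)) (k d r : ℕ) : Prop where
  finrank_eq : Module.finrank F D = k
  minDist : HasMinDist D d
  locality : HasLocality D r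

variable (F) in
/-- The largest dimension of a linear code over `F` of length `n` and minimum distance at
least `d`; the zero code counts, so the value is `0` when there is no other such code. -/
def kOpt [DecidableEq F] (n d : ℕ) : ℕ :=
  sSup {k | ∃ D : Submodule F (Fin n → F), Module.finrank F D = k ∧
    ∀ x ∈ D, ∀ y ∈ D, x ≠ y → d ≤ hammingDist x y}

/-- An LRC whose parameters meet the Singleton-like bound with equality:
`d = n - k - ⌈k / r⌉ + 2`. -/
def IsDistanceOptimalLRC [DecidableEq F] {n : ℕ} (D : Submodule F (Fin n → F))
    (k d r : ℕ) : Prop :=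
  IsLRC D k d r ∧ (d : ℤ) = (n : ℤ) - k - ⌈(k : ℚ) / (r : ℚ)⌉ + 2

/-- An LRC whose parameters meet the Cadambe–Mazumdar bound with equality:
`k = min_{t ≥ 0} (t r + k_opt(n - t (r + 1), d))`. The subtraction is truncated, so that
`k_opt` is `0` at nonpositive lengths. -/
def IsDimensionOptimalLRC [DecidableEq F] {n : ℕ} (D : Submodule F (Fin n → F))
    (k d r : ℕ) : Prop :=
  IsLRC D k d r ∧ IsLeast (Set.range fun t : ℕ => t * r + kOpt F (n - t * (r + 1)) d) k

end LRCCode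

end

/-! Write `x = δ⁻¹`, `y = δ⁻ˢ` and `n = q ^ 2 + 1`. By Delsarte-type duality the words of the code
are `(Tr (a xⁱ + b yⁱ))ᵢ` with `a, b` in `K`. Once the factor `xⁱ` is removed, the `i`-th symbol is
the value of a polynomial `sectionPoly` of degree at most `q + 1` at `u = θ ^ i`, where `θ` is a
primitive `n`-th root of unity. The two conditions on `r` and `s` are what make this reduction work.

Hence a nonzero word has at most `q + 1` zeros. The coefficients of the polynomial are conjugate in
pairs, so the columns of the code behave like an elliptic quadric: some plane section avoiding a
given point has exactly `q + 1` points (`exists_sectionPoly_dvd_eval_ne_zero`), and no three points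
are collinear (`exists_sectionPoly_secant`). This is recorded as `IsOvoidCode`.

The rest is formal. Words with `q + 1` zeros are parity checks of weight `q ^ 2 - q` for the dual,
giving the locality. A smaller recovering set would leave more than `q + 1` coordinates outside it,
and these impose no check. Non-collinearity gives distance at least 4, and four coplanar points give
a dual word of weight 4 when `q > 2`. Both optimality claims then reduce to arithmetic, using
Reed–Solomon codes of length `q + 1`. -/

namespace LRCCode
open Polynomial

/-! ### Dual words from restriction to a set of coordinates -/

section Duality

variable {F : Type*} [Field F] {n : ℕ}

lemma sum_mul_apply_single (ψ : (Fin n → F) →ₗ[F] F) (c : Fin n → F) :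
    ∑ i, ψ (Pi.single i 1) * c i = ψ c := by
  conv_rhs => rw [LinearMap.pi_apply_eq_sum_univ ψ c]
  refine Finset.sum_congr rfl fun i _ => ?_
  rw [smul_eq_mul, mul_comm]
  congr 2
  ext j
  simp [Pi.single_apply, eq_comm]

/-- The dual code is the dual annihilator, read in coordinates. -/
lemma finrank_add_finrank_dual (W : Submodule F (Fin n → F)) :
    Module.finrank F W + Module.finrank F (dual W) = n := by
  let e : (Fin n → F) ≃ₗ[F] Module.Dual F (Fin n → F) := dotProductEquiv F (Fin n)
  have h : dual W = W.dualAnnihilator.comap e.toLinearMap := by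
    ext x
    simp only [Submodule.mem_comap, Submodule.mem_dualAnnihilator]
    exact Iff.rfl
  have h2 : Module.finrank F (dual W) = Module.finrank F W.dualAnnihilator := by
    rw [h]
    exact (e.ofSubmodule' _).finrank_eq
  rw [h2, Subspace.finrank_add_finrank_dualAnnihilator_eq]
  simp

/-- Restriction of words to the coordinates in `J`. -/
def restrict (J : Finset (Fin n)) : (Fin n → F) →ₗ[F] (J → F) :=
  LinearMap.funLeft F F (Subtype.val : J → Fin n)

lemma restrict_single_of_notMem {J : Finset (Fin n)} {i : Fin n} (hi : i ∉ J) :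
    restrict J (Pi.single i (1 : F)) = 0 := by
  ext j
  have : (j : Fin n) ≠ i := fun h => hi (h ▸ j.2)
  simp [restrict, LinearMap.funLeft_apply, this]

lemma restrict_eq_zero_iff {J : Finset (Fin n)} {c : Fin n → F} :
    restrict J c = 0 ↔ ∀ j ∈ J, c j = 0 := by
  simp [funext_iff, restrict, LinearMap.funLeft_apply]

/-- If some nonzero word of `W` vanishes on a set `J` of size at least `dim W`, then `J` contains
the support of a nonzero dual word. -/
lemma exists_mem_dual_supported {W : Submodule F (Fin n → F)} {J : Finset (Fin n)}
    (hJ : Module.finrank F W ≤ J.card) {c : Fin n → F} (hcW : c ∈ W) (hc : c ≠ 0)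
    (hcJ : ∀ j ∈ J, c j = 0) : ∃ y ∈ dual W, y ≠ 0 ∧ ∀ i ∉ J, y i = 0 := by
  set ρ : W →ₗ[F] (J → F) := restrict J ∘ₗ W.subtype with hρ
  have hker : 0 < Module.finrank F (LinearMap.ker ρ) := by
    have : Nontrivial (LinearMap.ker ρ) := by
      refine ⟨⟨⟨⟨c, hcW⟩, ?_⟩, 0, ?_⟩⟩
      · simpa [hρ] using restrict_eq_zero_iff.2 hcJ
      · simpa [Subtype.ext_iff] using hc
    exact Module.finrank_pos (R := F) (M := LinearMap.ker ρ)
  -- Restriction to `J` is not injective on `W`, so by rank–nullity it is not onto. A functional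
  -- vanishing on its range is the required dual word.
  have hrange : LinearMap.range ρ < ⊤ := by
    refine lt_top_iff_ne_top.2 fun h => ?_
    have h1 := LinearMap.finrank_range_add_finrank_ker ρ
    rw [h, finrank_top] at h1
    simp at h1
    omega
  obtain ⟨φ, hφ, hle⟩ := Submodule.exists_le_ker_of_lt_top _ hrange
  refine ⟨fun i => φ (restrict J (Pi.single i 1)), fun d hd => ?_, fun h0 => hφ ?_, fun i hi => ?_⟩
  · refine (sum_mul_apply_single (φ ∘ₗ restrict J) d).trans ?_
    exact hle ⟨⟨d, hd⟩, rfl⟩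
  · have hsurj : Function.Surjective (restrict (F := F) J) :=
      LinearMap.funLeft_surjective_of_injective _ _ _ Subtype.val_injective
    refine LinearMap.ext fun v => ?_
    obtain ⟨d, rfl⟩ := hsurj v
    have := sum_mul_apply_single (φ ∘ₗ restrict J) d
    simp only [LinearMap.comp_apply] at this
    rw [← this]
    exact Finset.sum_eq_zero fun i _ => by rw [show φ _ = 0 from congrFun h0 i, zero_mul]
  · simp [restrict_single_of_notMem hi]

/-- If every word of `W` vanishing on `J` vanishes at `i`, then some dual word takes the value `1`
at `i` and is supported in `J ∪ {i}`. -/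
lemma exists_mem_dual_recovering {W : Submodule F (Fin n → F)} {J : Finset (Fin n)} {i : Fin n}
    (hi : i ∉ J) (h : ∀ c ∈ W, (∀ j ∈ J, c j = 0) → c i = 0) :
    ∃ y ∈ dual W, y i = 1 ∧ ∀ k ∉ J, k ≠ i → y k = 0 := by
  set ρ : W →ₗ[F] (J → F) := restrict J ∘ₗ W.subtype with hρ
  set ψ : (Fin n → F) →ₗ[F] F := LinearMap.proj i
  have hmem : ψ ∘ₗ W.subtype ∈ (LinearMap.ker ρ).dualAnnihilator := by
    rw [Submodule.mem_dualAnnihilator]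
    rintro ⟨c, hc⟩ hk
    exact h c hc (restrict_eq_zero_iff.1 (by simpa [hρ] using hk))
  -- The `i`-th coordinate kills the kernel of the restriction to `J`, so it factors through it as
  -- `φ`; the dual word is the difference of the two functionals.
  rw [← LinearMap.range_dualMap_eq_dualAnnihilator_ker] at hmem
  obtain ⟨φ, hφ⟩ := hmem
  refine ⟨fun k => (ψ - φ ∘ₗ restrict J) (Pi.single k 1), fun d hd => ?_, ?_, fun k hk hki => ?_⟩
  · rw [sum_mul_apply_single]
    have := LinearMap.congr_fun hφ ⟨d, hd⟩
    simp only [LinearMap.dualMap_apply', hρ, LinearMap.comp_apply, Submodule.subtype_apply] at this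
    simp [this]
  · simp [restrict_single_of_notMem hi, ψ]
  · simp [restrict_single_of_notMem hk, ψ, hki.symm]

end Duality

/-! ### Minimum weight and the Singleton bound -/

section OptimalDimension

variable {F : Type*} [Field F] [DecidableEq F]

lemma hammingNorm_add_card_zeros {n : ℕ} (c : Fin n → F) :
    hammingNorm c + (Finset.univ.filter fun i => c i = 0).card = n := by
  have := Finset.card_filter_add_card_filter_not (s := (Finset.univ : Finset (Fin n)))
    (fun i => c i = 0)
  simp only [Finset.card_univ, Fintype.card_fin] at this
  rw [hammingNorm, add_comm]
  exact this

lemma forall_le_hammingDist_iff {n : ℕ} {D : Submodule F (Fin n → F)} {d : ℕ} :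
    (∀ x ∈ D, ∀ y ∈ D, x ≠ y → d ≤ hammingDist x y) ↔
      ∀ x ∈ D, x ≠ 0 → d ≤ hammingNorm x := by
  refine ⟨fun h x hx h0 => ?_, fun h x hx y hy hxy => ?_⟩
  · simpa using h x hx 0 D.zero_mem h0
  · rw [hammingDist_eq_hammingNorm]
    exact h _ (D.add_mem (D.neg_mem hx) hy) fun h0 => hxy (neg_add_eq_zero.1 h0)

lemma hasMinDist_iff {n : ℕ} {D : Submodule F (Fin n → F)} {d : ℕ} :
    HasMinDist D d ↔ (∃ x ∈ D, x ≠ 0 ∧ hammingNorm x = d) ∧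
      ∀ x ∈ D, x ≠ 0 → d ≤ hammingNorm x := by
  rw [← forall_le_hammingDist_iff]
  refine and_congr ⟨?_, ?_⟩ ⟨?_, ?_⟩
  · rintro ⟨x, hx, y, hy, hxy, rfl⟩
    exact ⟨-x + y, D.add_mem (D.neg_mem hx) hy, fun h0 => hxy (neg_add_eq_zero.1 h0),
      (hammingDist_eq_hammingNorm x y).symm⟩
  · rintro ⟨x, hx, h0, rfl⟩
    exact ⟨x, hx, 0, D.zero_mem, h0, by simp⟩
  · exact fun h x hx y hy hxy => h ⟨x, hx, y, hy, hxy, rfl⟩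
  · rintro h _ ⟨x, hx, y, hy, hxy, rfl⟩
    exact h x hx y hy hxy

lemma le_kOpt {n d : ℕ} {D : Submodule F (Fin n → F)}
    (hD : ∀ x ∈ D, x ≠ 0 → d ≤ hammingNorm x) : Module.finrank F D ≤ kOpt F n d := by
  refine le_csSup ⟨n, ?_⟩ ⟨D, rfl, forall_le_hammingDist_iff.2 hD⟩
  rintro _ ⟨E, rfl, -⟩
  simpa using E.finrank_le

/-- The Singleton bound. -/
lemma kOpt_le (n t : ℕ) : kOpt F n (t + 1) ≤ n - t := by
  refine csSup_le ⟨0, ⊥, by simp, by simp⟩ ?_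
  rintro _ ⟨D, rfl, hD⟩
  rw [forall_le_hammingDist_iff] at hD
  let ρ : D →ₗ[F] (Fin (n - t) → F) :=
    LinearMap.funLeft F F (Fin.castLE (Nat.sub_le n t)) ∘ₗ D.subtype
  have hinj : Function.Injective ρ := by
    rw [← LinearMap.ker_eq_bot, LinearMap.ker_eq_bot']
    rintro ⟨x, hx⟩ h0
    by_contra hne
    have h1 := hD x hx (by simpa [Subtype.ext_iff] using hne)
    have h2 := hammingNorm_add_card_zeros x
    have h3 : n - t ≤ (Finset.univ.filter fun i => x i = 0).card := by
      calc n - t = ((Finset.univ : Finset (Fin (n - t))).map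
            (Fin.castLEEmb (Nat.sub_le n t))).card := by simp
        _ ≤ _ := Finset.card_le_card fun i hi => by
            obtain ⟨j, -, rfl⟩ := Finset.mem_map.1 hi
            exact Finset.mem_filter.2 ⟨Finset.mem_univ _, congrFun h0 j⟩
    omega
  simpa using LinearMap.finrank_le_finrank_of_injective hinj

/-- Reed–Solomon codes meet the Singleton bound. -/
lemma sub_le_kOpt [Fintype F] {n : ℕ} (hn : n ≤ Fintype.card F) (t : ℕ) :
    n - t ≤ kOpt F n (t + 1) := by
  obtain ⟨α⟩ : Nonempty (Fin n ↪ F) :=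
    Function.Embedding.nonempty_of_card_le (by simpa using hn)
  let L : (Fin n → F) →ₗ[F] (Fin t → F) :=
    LinearMap.pi fun j => ∑ i, (α i ^ (j : ℕ)) • LinearMap.proj i
  have hL : ∀ x ∈ LinearMap.ker L, ∀ P : F[X], P.natDegree < t → ∑ i, P.eval (α i) * x i = 0 := by
    intro x hx P hP
    simp_rw [eval_eq_sum_range' hP, Finset.sum_mul]
    rw [Finset.sum_comm]
    refine Finset.sum_eq_zero fun j hj => ?_
    have := congrFun (LinearMap.mem_ker.1 hx) ⟨j, Finset.mem_range.1 hj⟩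
    simp only [L, LinearMap.pi_apply, LinearMap.sum_apply, LinearMap.smul_apply,
      LinearMap.proj_apply, smul_eq_mul, Pi.zero_apply] at this
    simp_rw [mul_assoc, ← Finset.mul_sum, this, mul_zero]
  have hker : n - t ≤ Module.finrank F (LinearMap.ker L) := by
    have h1 := LinearMap.finrank_range_add_finrank_ker L
    have h2 := (LinearMap.range L).finrank_le
    simp at h1 h2
    omega
  refine hker.trans (le_kOpt fun x hx h0 => ?_)
  by_contra! hlt
  obtain ⟨i, hi⟩ := Function.ne_iff.1 h0
  set T := (Finset.univ.filter fun j => x j ≠ 0) with hT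
  have hiT : i ∈ T := by simpa [hT] using hi
  have hcard : T.card ≤ t := Nat.lt_succ_iff.1 hlt
  -- Vanishing at every other support point, this polynomial isolates the term at `i`; its degree is
  -- below `t` because the support has at most `t` elements.
  have h1 := hL x hx (∏ j ∈ T.erase i, (X - C (α j))) (by
    rw [natDegree_prod_of_monic _ _ fun j _ => monic_X_sub_C _]
    simp only [natDegree_X_sub_C, Finset.sum_const, smul_eq_mul, mul_one]
    have := Finset.card_erase_lt_of_mem hiT
    omega)
  rw [Finset.sum_eq_single i] at h1
  · rcases mul_eq_zero.1 h1 with h1 | h1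
    · rw [eval_prod, Finset.prod_eq_zero_iff] at h1
      obtain ⟨j, hj, h⟩ := h1
      simp only [eval_sub, eval_X, eval_C, sub_eq_zero] at h
      exact (Finset.mem_erase.1 hj).1 (α.injective h).symm
    · exact hi h1
  · intro j _ hji
    by_cases hj : x j = 0
    · simp [hj]
    · rw [eval_prod, Finset.prod_eq_zero (i := j), zero_mul]
      · simp [hT, hji, hj]
      · simp
  · simp

end OptimalDimension

/-! ### Ovoid codes and the parameters of their duals -/

section OvoidCode

variable {F : Type*} [Field F] [DecidableEq F]

/-- A code of dimension `4` whose columns behave like the points of an ovoid of `PG(3, q)`: a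
hyperplane holds at most `q + 1` of them, every point is missed by a hyperplane attaining this
bound, and no three points are collinear. -/
structure IsOvoidCode (q : ℕ) (W : Submodule F (Fin (q ^ 2 + 1) → F)) : Prop where
  finrank_eq : Module.finrank F W = 4
  card_zeros_le : ∀ c ∈ W, c ≠ 0 → (Finset.univ.filter fun i => c i = 0).card ≤ q + 1
  exists_le_card_zeros : ∀ i, ∃ c ∈ W, c i ≠ 0 ∧
    q + 1 ≤ (Finset.univ.filter fun i => c i = 0).card
  exists_separating : ∀ i j k, k ≠ i → k ≠ j → ∃ c ∈ W, c i = 0 ∧ c j = 0 ∧ c k ≠ 0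

namespace IsOvoidCode

variable {q : ℕ} {W : Submodule F (Fin (q ^ 2 + 1) → F)}

lemma finrank_dual (hW : IsOvoidCode q W) : Module.finrank F (dual W) = q ^ 2 - 3 := by
  have := finrank_add_finrank_dual W
  rw [hW.finrank_eq] at this
  omega

/-- If the support had at most three elements, pairing with a word of `W` that vanishes at all of
them but `k` would leave a single nonzero term. -/
lemma four_le_hammingNorm (hW : IsOvoidCode q W) {y : Fin (q ^ 2 + 1) → F} (hy : y ∈ dual W)
    (h0 : y ≠ 0) : 4 ≤ hammingNorm y := by
  by_contra! hlt
  obtain ⟨k, hk⟩ := Function.ne_iff.1 h0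
  set T := (Finset.univ.filter fun j => y j ≠ 0) with hT
  have hkT : k ∈ T := by simpa [hT] using hk
  have hcard : (T.erase k).card ≤ 2 := by
    rw [Finset.card_erase_of_mem hkT]
    have : T.card < 4 := hlt
    omega
  -- The indices `i` and `j` may coincide or lie outside the support, which covers weights 1 and 2
  -- as well.
  obtain ⟨i, j, hki, hkj, hsub⟩ : ∃ i j, k ≠ i ∧ k ≠ j ∧ ∀ l, l ≠ k → y l ≠ 0 → l = i ∨ l = j := by
    have hmem : ∀ l, l ≠ k → y l ≠ 0 → l ∈ T.erase k := fun l h1 h2 => by simp [hT, h1, h2]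
    have hne : ∀ l ∈ T.erase k, k ≠ l := fun l hl => (Finset.ne_of_mem_erase hl).symm
    rcases Nat.lt_or_ge (T.erase k).card 1 with h | h
    · have he : T.erase k = ∅ := Finset.card_eq_zero.1 (by omega)
      have hnt : 1 < q ^ 2 + 1 := by
        have hcz := finrank_add_finrank_dual W
        rw [hW.finrank_eq] at hcz
        omega
      have : Nontrivial (Fin (q ^ 2 + 1)) := Fin.nontrivial_iff_two_le.2 hnt
      obtain ⟨i, hi⟩ := exists_ne k
      refine ⟨i, i, hi.symm, hi.symm, fun l h1 h2 => ?_⟩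
      have := hmem l h1 h2
      simp [he] at this
    · rcases Nat.lt_or_ge (T.erase k).card 2 with h' | h'
      · obtain ⟨i, hi⟩ := Finset.card_eq_one.1 (show (T.erase k).card = 1 by omega)
        have := hne i (by simp [hi])
        refine ⟨i, i, this, this, fun l h1 h2 => ?_⟩
        have := hmem l h1 h2
        simp_all
      · obtain ⟨i, j, -, hij⟩ := Finset.card_eq_two.1 (show (T.erase k).card = 2 by omega)
        refine ⟨i, j, hne i (by simp [hij]), hne j (by simp [hij]), fun l h1 h2 => ?_⟩
        have := hmem l h1 h2
        rw [hij] at this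
        simpa using this
  obtain ⟨c, hc, hci, hcj, hck⟩ := hW.exists_separating i j k hki hkj
  have := hy c hc
  rw [Finset.sum_eq_single k] at this
  · exact (mul_ne_zero hk hck) this
  · intro l _ hl
    by_cases h : y l = 0
    · simp [h]
    · rcases hsub l hl h with rfl | rfl <;> simp [*]
  · simp

/-- Suppose a dual word vanishes at `i` and not at `k`. A nonzero word of `W` can be made to vanish
at the other three coordinates, since `dim W = 4`. These already exhaust its `q + 1 = 3` zeros, so
it pairs nontrivially at `k`. -/
lemma five_le_hammingNorm {W : Submodule F (Fin (2 ^ 2 + 1) → F)} (hW : IsOvoidCode 2 W)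
    {y : Fin (2 ^ 2 + 1) → F} (hy : y ∈ dual W) (h0 : y ≠ 0) : 5 ≤ hammingNorm y := by
  by_contra! hlt
  obtain ⟨k, hk⟩ := Function.ne_iff.1 h0
  have hz : 0 < (Finset.univ.filter fun i => y i = 0).card := by
    have := hammingNorm_add_card_zeros y
    omega
  obtain ⟨i, hi⟩ := Finset.card_pos.1 hz
  have hyi : y i = 0 := by simpa using hi
  have hik : i ≠ k := fun h => hk (h ▸ hyi)
  set T : Finset (Fin (2 ^ 2 + 1)) := (Finset.univ.erase i).erase k with hT
  have hTc : T.card = 3 := by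
    rw [hT, Finset.card_erase_of_mem (by simp [hik.symm]), Finset.card_erase_of_mem (by simp)]
    simp
  let ρ : W →ₗ[F] (T → F) := restrict T ∘ₗ W.subtype
  obtain ⟨⟨c, hc⟩, hρ, hne⟩ : ∃ c : W, ρ c = 0 ∧ c ≠ 0 := by
    have hker := LinearMap.ker_ne_bot_of_finrank_lt (f := ρ) (by
      have := hW.finrank_eq
      rw [Module.finrank_fintype_fun_eq_card, Fintype.card_coe]
      omega)
    obtain ⟨c, h1, h2⟩ := (Submodule.ne_bot_iff _).1 hker
    exact ⟨c, h1, h2⟩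
  have hcT : ∀ j ∈ T, c j = 0 := restrict_eq_zero_iff.1 (by simpa [ρ] using hρ)
  have hc0 : c ≠ 0 := by simpa [Subtype.ext_iff] using hne
  have hck : c k ≠ 0 := by
    intro h
    have h1 := hW.card_zeros_le c hc hc0
    have h2 : (insert k T).card ≤ _ :=
      Finset.card_le_card (t := Finset.univ.filter fun i => c i = 0) fun j hj => by
        rcases Finset.mem_insert.1 hj with rfl | hj
        · simpa using h
        · simpa using hcT j hj
    rw [Finset.card_insert_of_notMem (by simp [hT]), hTc] at h2
    omega
  have := hy c hc
  rw [Finset.sum_eq_single k] at this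
  · exact (mul_ne_zero hk hck) this
  · intro l _ hl
    by_cases h : l = i
    · simp [h, hyi]
    · rw [hcT l (by simp [hT, h, hl]), mul_zero]
  · simp

lemma hasMinDist_dual (hW : IsOvoidCode q W) (hq : 2 ≤ q) :
    HasMinDist (dual W) (if q = 2 then 5 else 4) := by
  rw [hasMinDist_iff]
  split_ifs with h
  · subst h
    refine ⟨?_, fun y hy h0 => hW.five_le_hammingNorm hy h0⟩
    have : 0 < Module.finrank F (dual W) := by rw [hW.finrank_dual]; norm_num
    have := Module.finrank_pos_iff.1 this
    obtain ⟨⟨y, hy⟩, h0⟩ := exists_ne (0 : dual W)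
    have h0' : y ≠ 0 := by simpa [Subtype.ext_iff] using h0
    refine ⟨y, hy, h0', le_antisymm ?_ (hW.five_le_hammingNorm hy h0')⟩
    have := hammingNorm_add_card_zeros y
    omega
  · refine ⟨?_, fun y hy h0 => hW.four_le_hammingNorm hy h0⟩
    -- Since `q + 1 ≥ 4`, some hyperplane contains four of the points, which are therefore
    -- dependent.
    obtain ⟨c, hc, hc0, hcard⟩ := hW.exists_le_card_zeros 0
    obtain ⟨J, hJ, hJ4⟩ := Finset.exists_subset_card_eq
      (show 4 ≤ (Finset.univ.filter fun i => c i = 0).card by omega)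
    have hcJ : ∀ j ∈ J, c j = 0 := fun j hj => by simpa using hJ hj
    obtain ⟨y, hy, h0, hyJ⟩ := exists_mem_dual_supported
      (by rw [hW.finrank_eq, hJ4]) hc (fun h => hc0 (by simp [h])) hcJ
    refine ⟨y, hy, h0, le_antisymm ?_ (hW.four_le_hammingNorm hy h0)⟩
    rw [← hJ4]
    refine Finset.card_le_card fun i hi => ?_
    by_contra hiJ
    exact (Finset.mem_filter.1 hi).2 (hyJ i hiJ)

/-- A word of `W` with `q + 1` zeros and nonzero at `i` is a parity check of weight at most `q ^ 2 -
q`; solve it for the `i`-th symbol. -/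
lemma hasLocality_dual (hW : IsOvoidCode q W) : HasLocality (dual W) (q ^ 2 - q - 1) := by
  intro i
  obtain ⟨c, hc, hci, hcard⟩ := hW.exists_le_card_zeros i
  set R := (Finset.univ.filter fun j => c j ≠ 0).erase i with hR
  refine ⟨R.card, ?_, R, by simp [hR], rfl, fun v => -(c i)⁻¹ * ∑ j : R, v j * c j, ?_⟩
  · have h1 := hammingNorm_add_card_zeros c
    rw [hR, Finset.card_erase_of_mem (by simpa using hci)]
    have h2 : (Finset.univ.filter fun j => c j ≠ 0).card = hammingNorm c := rfl
    omega
  · intro x hx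
    have h := hx c hc
    change x i = -(c i)⁻¹ * ∑ j : R, x j * c j
    rw [Finset.sum_coe_sort R (fun j => x j * c j)]
    have h2 : ∑ j, x j * c j = x i * c i + ∑ j ∈ R, x j * c j := by
      rw [← Finset.add_sum_erase _ _ (Finset.mem_univ i)]
      congr 1
      symm
      refine Finset.sum_subset (fun j hj => ?_) fun j hj hjR => ?_
      · simp [Finset.ne_of_mem_erase hj]
      · have : c j = 0 := by
          by_contra hne
          exact hjR (by simp [hR, hne, Finset.ne_of_mem_erase hj])
        simp [this]
    rw [h2] at h
    field_simp
    linear_combination h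

/-- If `R` is too small, the complement of `R ∪ {0}` has more than `q + 1` elements, so only the
zero word of `W` vanishes on it. Some dual word is then `1` at `0` and zero on `R`, and `R` cannot
distinguish it from the zero word. -/
lemma le_of_hasLocality_dual (hW : IsOvoidCode q W) {l : ℕ} (hl : HasLocality (dual W) l) :
    q ^ 2 - q - 1 ≤ l := by
  obtain ⟨t, ht, R, hiR, rfl, f, hf⟩ := hl 0
  refine le_trans ?_ ht
  by_contra! hlt
  set J := (insert 0 R)ᶜ with hJ
  have hJc : J.card = q ^ 2 - R.card := by
    rw [hJ, Finset.card_compl, Finset.card_insert_of_notMem hiR]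
    simp
  obtain ⟨y, hy, hy0, hyJ⟩ := exists_mem_dual_recovering (W := W) (J := J) (i := 0) (by simp [hJ])
    (fun c hc hcJ => by
      by_contra hne
      have h1 := hW.card_zeros_le c hc (fun h => hne (by simp [h]))
      have h2 : J.card ≤ _ :=
        Finset.card_le_card (t := Finset.univ.filter fun i => c i = 0) fun j hj => by
          simpa using hcJ j hj
      omega)
  have h1 := hf y hy
  have h2 := hf 0 (Submodule.zero_mem _)
  have h3 : (fun j : R => y j) = fun j : R => (0 : Fin (q ^ 2 + 1) → F) j := by
    ext j
    have hj0 : (j : Fin (q ^ 2 + 1)) ≠ 0 := fun h => hiR (h ▸ j.2)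
    exact hyJ j (by simp [hJ]) hj0
  rw [h3, ← h2, hy0] at h1
  simp at h1

lemma isLRC_dual (hW : IsOvoidCode q W) (hq : 2 ≤ q) :
    IsLRC (dual W) (q ^ 2 - 3) (if q = 2 then 5 else 4) (q ^ 2 - q - 1) :=
  ⟨hW.finrank_dual, hW.hasMinDist_dual hq, hW.hasLocality_dual⟩

lemma isDistanceOptimalLRC_dual (hW : IsOvoidCode q W) (hq : 2 ≤ q) :
    IsDistanceOptimalLRC (dual W) (q ^ 2 - 3) (if q = 2 then 5 else 4) (q ^ 2 - q - 1) := by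
  refine ⟨hW.isLRC_dual hq, ?_⟩
  split_ifs with h
  · subst h
    norm_num
  · have h3 : 3 ≤ q := by omega
    have e1 : ((q ^ 2 - 3 : ℕ) : ℤ) = (q : ℤ) ^ 2 - 3 := by
      rw [Nat.cast_sub (by nlinarith)]; push_cast; ring
    have e2 : ((q ^ 2 - 3 : ℕ) : ℚ) = (q : ℚ) ^ 2 - 3 := by
      rw [Nat.cast_sub (by nlinarith)]; push_cast; ring
    have e3 : ((q ^ 2 - q - 1 : ℕ) : ℚ) = (q : ℚ) ^ 2 - q - 1 := by
      rw [Nat.sub_sub, Nat.cast_sub (by nlinarith)]; push_cast; ring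
    have hq3 : (3 : ℚ) ≤ q := by exact_mod_cast h3
    -- The quotient exceeds 1 because `q > 2`, and is at most 2 because `(q - 1) ^ 2 ≥ 0`.
    have hceil : ⌈((q ^ 2 - 3 : ℕ) : ℚ) / ((q ^ 2 - q - 1 : ℕ) : ℚ)⌉ = 2 := by
      have hpos : (0 : ℚ) < (q : ℚ) ^ 2 - q - 1 := by nlinarith
      rw [e2, e3, Int.ceil_eq_iff, lt_div_iff₀ hpos, div_le_iff₀ hpos]
      push_cast
      constructor <;> nlinarith
    rw [hceil, e1]
    push_cast
    ring

lemma isDimensionOptimalLRC_dual [Fintype F] (hF : Fintype.card F = q ^ 2)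
    (hW : IsOvoidCode q W) (hq : 2 ≤ q) :
    IsDimensionOptimalLRC (dual W) (q ^ 2 - 3) (if q = 2 then 5 else 4) (q ^ 2 - q - 1) := by
  have hlrc := hW.isLRC_dual hq
  have hq2 : 2 * q ≤ q ^ 2 := by nlinarith
  have hlen : q ^ 2 + 1 - 1 * (q ^ 2 - q - 1 + 1) = q + 1 := by omega
  -- The minimum is attained at `t = 1`, where the remaining length is `q + 1 ≤ q ^ 2`, within reach
  -- of Reed–Solomon codes.
  have hone : 1 * (q ^ 2 - q - 1) + kOpt F (q + 1) (if q = 2 then 5 else 4) = q ^ 2 - 3 := by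
    have hle : q + 1 ≤ Fintype.card F := by omega
    split_ifs with h
    · have h1 : kOpt F (q + 1) 5 ≤ q + 1 - 4 := kOpt_le (q + 1) 4
      have h2 : kOpt F (q + 1) 5 = 0 := by omega
      rw [h2]; subst h; norm_num
    · have h1 : kOpt F (q + 1) 4 ≤ q + 1 - 3 := kOpt_le (q + 1) 3
      have h2 : q + 1 - 3 ≤ kOpt F (q + 1) 4 := sub_le_kOpt hle 3
      have h3 : kOpt F (q + 1) 4 = q - 2 := by omega
      have : 3 * q ≤ q ^ 2 := by nlinarith [show 3 ≤ q by omega]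
      omega
  refine ⟨hlrc, ⟨1, ?_⟩, ?_⟩
  · simp only
    rw [hlen, hone]
  · rintro _ ⟨t, rfl⟩
    simp only
    rcases t with _ | _ | t
    · simp only [zero_mul, tsub_zero, zero_add]
      rw [← hlrc.finrank_eq]
      exact le_kOpt (hasMinDist_iff.1 hlrc.minDist).2
    · rw [zero_add, hlen, hone]
    -- For `t ≥ 2` the term `t * r` alone is at least `q ^ 2 - 3`.
    · have : 2 * (q ^ 2 - q - 1) ≤ (t + 1 + 1) * (q ^ 2 - q - 1) :=
        Nat.mul_le_mul_right _ (by omega)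
      have : 2 * q ≤ q ^ 2 + 1 := by omega
      omega

end IsOvoidCode

end OvoidCode

/-! ### Plane sections of the quadric as polynomials -/

section Sections

variable {K : Type*} [Field K]

/-- The polynomial `a + b X + b ^ (q ^ 2) X ^ q + a ^ (q ^ 2) X ^ (q + 1)`. -/
noncomputable def sectionPoly (q : ℕ) (a b : K) : K[X] :=
  C a + C b * X + C (b ^ q ^ 2) * X ^ q + C (a ^ q ^ 2) * X ^ (q + 1)

lemma eval_sectionPoly (q : ℕ) (a b u : K) : (sectionPoly q a b).eval u =
    a + b * u + b ^ q ^ 2 * u ^ q + a ^ q ^ 2 * u ^ (q + 1) := by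
  simp [sectionPoly]

lemma natDegree_sectionPoly_le (q : ℕ) (a b : K) : (sectionPoly q a b).natDegree ≤ q + 1 := by
  unfold sectionPoly
  compute_degree

lemma natDegree_sectionPoly {q : ℕ} (hq : q ≠ 0) {a : K} (ha : a ≠ 0) (b : K) :
    (sectionPoly q a b).natDegree = q + 1 := by
  refine natDegree_eq_of_le_of_coeff_ne_zero (natDegree_sectionPoly_le q a b) ?_
  simp [sectionPoly, coeff_C, coeff_X_pow, hq, ha, -map_pow]

lemma sectionPoly_ne_zero {q : ℕ} (hq : 2 ≤ q) {a b : K} (h : a ≠ 0 ∨ b ≠ 0) :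
    sectionPoly q a b ≠ 0 := by
  intro h0
  have e0 := congrArg (coeff · 0) h0
  have e1 := congrArg (coeff · 1) h0
  have hq1 : ¬ (1 = q) := by omega
  have hq0 : q ≠ 0 := by omega
  simp [sectionPoly, coeff_X_pow, coeff_X, hq0, hq0.symm, hq1, -map_pow] at e0 e1
  tauto

/-- A nonzero polynomial of degree less than the order of a finite field has a nonroot. -/
lemma exists_eval_ne_zero [Fintype K] {f : K[X]} (hf : f ≠ 0)
    (hdeg : f.natDegree < Fintype.card K) : ∃ a, f.eval a ≠ 0 := by
  by_contra! h
  exact hf (eq_zero_of_natDegree_lt_card_of_eval_eq_zero f Function.injective_id h hdeg)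

/-- Hilbert's Theorem 90 for the extension of degree two. -/
lemma exists_pow_eq_mul [Fintype K] {Q : ℕ} (hQ : 2 ≤ Q) (hK : Fintype.card K = Q ^ 2)
    (hadd : ∀ x y : K, (x + y) ^ Q = x ^ Q + y ^ Q) {v : K} (hv : v ^ (Q + 1) = 1) :
    ∃ c : K, c ≠ 0 ∧ c ^ Q = v * c := by
  have hv0 : v ≠ 0 := by
    rintro rfl
    simp at hv
  -- Lagrange resolvent: `c = z + v⁻¹ z ^ Q` satisfies `c ^ Q = z ^ Q + v z = v c`, and `z` is
  -- chosen to make it nonzero.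
  obtain ⟨z, hz⟩ := exists_eval_ne_zero (f := X + C v⁻¹ * X ^ Q)
    (fun h => by
      have e1 := congrArg (coeff · 1) h
      have : ¬ (1 = Q) := by omega
      simp [coeff_X_pow, this] at e1)
    (lt_of_le_of_lt (b := Q) (by compute_degree; all_goals omega) (by rw [hK]; nlinarith))
  refine ⟨_, hz, ?_⟩
  have h1 : (z ^ Q) ^ Q = z := by rw [← pow_mul, ← sq, ← hK, FiniteField.pow_card]
  have h2 : v⁻¹ ^ Q = v := by
    rw [inv_pow, inv_eq_iff_eq_inv]
    exact eq_inv_of_mul_eq_one_left (by rw [← pow_succ, hv])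
  simp only [eval_add, eval_X, eval_mul, eval_C, eval_pow]
  rw [hadd, mul_pow, h1, h2]
  field_simp
  ring

/-- For any two `(q ^ 2 + 1)`-th roots of unity some section vanishes there and at no other
such root. -/
lemma exists_sectionPoly_secant [Fintype K] {q : ℕ} (hq : 2 ≤ q) (hK : Fintype.card K = q ^ 4)
    (hadd : ∀ x y : K, (x + y) ^ q = x ^ q + y ^ q) {u₁ u₂ : K} (h₁ : u₁ ^ (q ^ 2 + 1) = 1)
    (h₂ : u₂ ^ (q ^ 2 + 1) = 1) :
    ∃ a b c : K, c ≠ 0 ∧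
      ∀ u, (sectionPoly q a b).eval u = c * (u - u₁) * (u ^ q - u₂ ^ q) := by
  have hadd2 : ∀ x y : K, (x + y) ^ q ^ 2 = x ^ q ^ 2 + y ^ q ^ 2 := fun x y => by
    simp only [sq, pow_mul, hadd]
  -- Expanding `c (u - u₁) (u ^ q - u₂ ^ q)` determines `a` and `b`. The remaining two coefficients
  -- are their conjugates exactly when `c ^ (q ^ 2) = u₁ u₂ ^ q c`.
  have hw : (u₂ ^ q) ^ (q ^ 2 + 1) = 1 := by rw [← pow_mul, mul_comm, pow_mul, h₂, one_pow]
  obtain ⟨c, hc, hcQ⟩ := exists_pow_eq_mul (Q := q ^ 2) (by nlinarith) (by rw [hK]; ring) hadd2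
    (v := u₂ ^ q * u₁) (by rw [mul_pow, hw, h₁, one_mul])
  have hneg : ∀ x : K, (-x) ^ q ^ 2 = -x ^ q ^ 2 := fun x => by
    have := hadd2 x (-x)
    rw [add_neg_cancel, zero_pow (by positivity)] at this
    linear_combination -this
  refine ⟨c * u₂ ^ q * u₁, -(c * u₂ ^ q), c, hc, fun u => ?_⟩
  rw [eval_sectionPoly, hneg]
  simp only [mul_pow, hcQ]
  rw [pow_succ] at hw h₁
  linear_combination (u₁ * c * u ^ (q + 1) * (u₁ ^ q ^ 2)  - u₁ * c * u ^ q) * hw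
    + (c * u ^ (q + 1)) * h₁

/-- The sections `Tr (a x)` of the subgeometry over `F_q` divide `X ^ (q ^ 2 + 1) - 1`. -/
lemma sectionPoly_dvd {q : ℕ} (p m : ℕ) [hp : Fact p.Prime] [CharP K p] (hq : q = p ^ m)
    {a : K} (hK : a ^ q ^ 4 = a) (ha : a ^ (q ^ 2 + 1) ≠ (a ^ (q ^ 2 + 1)) ^ q) :
    sectionPoly q a (a ^ q) ∣ X ^ (q ^ 2 + 1) - 1 := by
  have hadd : ∀ x y : K[X], (x + y) ^ q = x ^ q + y ^ q := fun x y => by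
    rw [hq, add_pow_char_pow]
  set P := sectionPoly q a (a ^ q) with hP
  set e := a ^ (q ^ 2 + 1) - (a ^ (q ^ 2 + 1)) ^ q with he
  have he0 : e ≠ 0 := sub_ne_zero.2 ha
  have hPq : P ^ q = C (a ^ q) + C (a ^ q ^ 2) * X ^ q + C a * X ^ q ^ 2 +
      C (a ^ q ^ 3) * (X ^ q ^ 2 * X ^ q) := by
    rw [hP, sectionPoly, hadd, hadd, hadd]
    simp only [mul_pow, ← C_pow, ← pow_mul]
    have e1 : q * q ^ 2 * q = q ^ 4 := by ring
    have e2 : q * q = q ^ 2 := by ring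
    have e3 : q ^ 2 * q = q ^ 3 := by ring
    have e4 : (q + 1) * q = q ^ 2 + q := by ring
    rw [e1, e2, e3, e4, hK, pow_add]
  -- Both `P` and `P ^ q` are affine in `X ^ q`; eliminating `X ^ q` between them, as in a
  -- resultant, leaves a multiple of `X ^ (q ^ 2 + 1) - 1`.
  have key : C e * (X ^ (q ^ 2 + 1) - 1) =
      P * (P ^ (q - 1) * (C (a ^ q ^ 3) + C (a ^ q ^ 2) * X) - C (a ^ q ^ 2) -
        C (a ^ q ^ 3) * X ^ q ^ 2) := by
    have hq0 : q ≠ 0 := by rw [hq]; exact (pow_pos hp.out.pos _).ne'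
    have h1 : P * P ^ (q - 1) = P ^ q := mul_pow_sub_one hq0 P
    rw [mul_sub P, mul_sub P, ← mul_assoc P, h1, hPq, hP, sectionPoly, he]
    have e0 : (a ^ q) ^ q ^ 2 = a ^ q ^ 3 := by rw [← pow_mul]; congr 1; ring
    have e1 : (a ^ (q ^ 2 + 1)) ^ q = a ^ q ^ 3 * a ^ q := by
      rw [← pow_mul, ← pow_add]; congr 1; ring
    rw [e0, e1, pow_succ a, pow_succ X, pow_succ X]
    simp only [C_sub, C_mul]
    ring
  have : P ∣ C e * (X ^ (q ^ 2 + 1) - 1) := ⟨_, key⟩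
  exact (Associated.dvd_iff_dvd_right (associated_unit_mul_left _ _
    (isUnit_C.2 he0.isUnit))).1 this

/-- Some section over the subfield `F_q` misses a given point. -/
lemma exists_sectionPoly_dvd_eval_ne_zero [Fintype K] {q : ℕ} (p m : ℕ) [hp : Fact p.Prime]
    [CharP K p] (hq : q = p ^ m) (hq2 : 2 ≤ q) (hK : Fintype.card K = q ^ 4) (u : K) :
    ∃ a b : K, a ≠ 0 ∧ sectionPoly q a b ∣ X ^ (q ^ 2 + 1) - 1 ∧ (sectionPoly q a b).eval u ≠ 0 := by
  -- Here `a` is the variable: `f a` is the value at `u` of the section with `b = a ^ q`, and `g a ≠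
  -- 0` says that `a ≠ 0` and `a ^ (q ^ 2 + 1)` is not fixed by the `q`-th power. The product `f *
  -- g` has degree below `q ^ 4`, so some `a` satisfies both.
  set f : K[X] := X + C u * X ^ q + C (u ^ q) * X ^ q ^ 3 + C (u ^ (q + 1)) * X ^ q ^ 2 with hf
  set g : K[X] := X ^ ((q ^ 2 + 1) * (q - 1) + 1) - X with hg
  obtain ⟨k, rfl⟩ : ∃ k, q = k + 2 := ⟨q - 2, by omega⟩
  have hf0 : f ≠ 0 := by
    intro h
    have e1 := congrArg (coeff · 1) h
    have h2 : ¬ (1 = (k + 2) ^ 2) := by nlinarith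
    have h3 : ¬ (1 = (k + 2) ^ 3) := by
      have := Nat.one_lt_pow (n := 3) (by norm_num) (show 1 < k + 2 by omega)
      omega
    simp [hf, coeff_X_pow, h2, h3, -map_pow] at e1
  have hgdeg : g.natDegree ≤ ((k + 2) ^ 2 + 1) * (k + 1) + 1 := by
    rw [hg]
    compute_degree
  have hg0 : g ≠ 0 := by
    intro h
    have e1 := congrArg (coeff · 1) h
    simp [hg, coeff_X_pow] at e1
  have hfdeg : f.natDegree ≤ (k + 2) ^ 3 := by
    have h2 : (k + 2) ^ 2 ≤ (k + 2) ^ 3 := Nat.pow_le_pow_right (by omega) (by omega)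
    have h1 : k + 2 ≤ (k + 2) ^ 3 := Nat.le_self_pow (by omega) _
    rw [hf]
    compute_degree
    all_goals omega
  obtain ⟨a, ha⟩ := exists_eval_ne_zero (mul_ne_zero hf0 hg0) (by
    rw [natDegree_mul hf0 hg0, hK]
    refine lt_of_le_of_lt (add_le_add hfdeg hgdeg) ?_
    ring_nf
    nlinarith [sq_nonneg k, pow_nonneg (Nat.zero_le k) 3])
  rw [eval_mul] at ha
  have hfa := left_ne_zero_of_mul ha
  have hga := right_ne_zero_of_mul ha
  have hpow : a ^ (k + 2) ^ 4 = a := by rw [← hK, FiniteField.pow_card]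
  have ha0 : a ≠ 0 := by
    rintro rfl
    simp [hg] at hga
  refine ⟨a, a ^ (k + 2), ha0, sectionPoly_dvd p m hq hpow fun h => hga ?_, ?_⟩
  · simp only [hg, eval_sub, eval_pow, eval_X, sub_eq_zero]
    set N := a ^ ((k + 2) ^ 2 + 1) with hN
    have hN0 : N ≠ 0 := pow_ne_zero _ ha0
    have h1 : N ^ (k + 1) = 1 := by
      rw [pow_succ N (k + 1)] at h
      exact mul_right_cancel₀ hN0 (by rw [one_mul, ← h])
    rw [show k + 2 - 1 = k + 1 from rfl, pow_succ a, pow_mul, ← hN, h1, one_mul]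
  · convert hfa using 1
    have e0 : (a ^ (k + 2)) ^ (k + 2) ^ 2 = a ^ (k + 2) ^ 3 := by rw [← pow_mul]; congr 1; ring
    rw [eval_sectionPoly, e0, hf]
    simp only [eval_add, eval_X, eval_mul, eval_C, eval_pow]
    ring

end Sections

/-! ### Counting zeros on a set of points -/

section Zeros

variable {K : Type*} [Field K] [DecidableEq K] {ι : Type*} [Fintype ι] {u : ι → K}

lemma card_filter_eval_eq_zero_le (hu : Function.Injective u) {f : K[X]} (hf : f ≠ 0) :
    (Finset.univ.filter fun i => f.eval (u i) = 0).card ≤ f.natDegree := by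
  rw [← Finset.card_map ⟨u, hu⟩]
  refine (Finset.card_le_card (t := f.roots.toFinset) fun x hx => ?_).trans
    ((Multiset.toFinset_card_le _).trans (card_roots' f))
  obtain ⟨i, hi, rfl⟩ := Finset.mem_map.1 hx
  simpa [hf] using hi

/-- The cofactor of `f` vanishes at no more points than its degree, so `f` must vanish at all the
others. -/
lemma natDegree_le_card_filter_of_dvd (hu : Function.Injective u) {f g : K[X]} (hg : g ≠ 0)
    (hdeg : g.natDegree ≤ Fintype.card ι) (hgu : ∀ i, g.eval (u i) = 0) (hfg : f ∣ g) :
    f.natDegree ≤ (Finset.univ.filter fun i => f.eval (u i) = 0).card := by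
  classical
  obtain ⟨h, rfl⟩ := hfg
  have hf0 := left_ne_zero_of_mul hg
  have hh0 := right_ne_zero_of_mul hg
  have h1 := card_filter_eval_eq_zero_le hu hh0
  have h2 : (Finset.univ : Finset ι).card ≤ _ :=
    (Finset.card_le_card (t := (Finset.univ.filter fun i => f.eval (u i) = 0) ∪
      Finset.univ.filter fun i => h.eval (u i) = 0) fun i _ => by
        simpa using hgu i).trans (Finset.card_union_le _ _)
  rw [natDegree_mul hf0 hh0] at hdeg
  rw [Finset.card_univ] at h2
  omega

end Zeros

/-! ### Trace description of constacyclic codes -/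

section TraceCode

variable {F K : Type*} [Field F] [Field K] [Algebra F K]

variable (F) in
/-- The words `(Tr (a xⁱ + b yⁱ))ᵢ`. -/
noncomputable def traceWord (n : ℕ) (x y : K) : K × K →ₗ[F] (Fin n → F) :=
  LinearMap.pi fun i => Algebra.trace F K ∘ₗ
    (LinearMap.mulRight F (x ^ (i : ℕ)) ∘ₗ LinearMap.fst F K K +
      LinearMap.mulRight F (y ^ (i : ℕ)) ∘ₗ LinearMap.snd F K K)

lemma traceWord_apply (n : ℕ) (x y a b : K) (i : Fin n) :
    traceWord F n x y (a, b) i = Algebra.trace F K (a * x ^ (i : ℕ) + b * y ^ (i : ℕ)) := rfl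

/-- The polynomial `∑ cᵢ Xⁱ` of a word. -/
noncomputable def wordPoly {n : ℕ} (c : Fin n → F) : F[X] := ∑ i : Fin n, C (c i) * X ^ (i : ℕ)

lemma coeff_wordPoly {n : ℕ} (c : Fin n → F) (i : Fin n) : (wordPoly c).coeff i = c i := by
  simp [wordPoly, coeff_X_pow, Fin.val_inj]

lemma natDegree_wordPoly_lt {n : ℕ} (hn : 0 < n) (c : Fin n → F) : (wordPoly c).natDegree < n := by
  refine lt_of_le_of_lt (natDegree_sum_le_of_forall_le (n := n - 1) _ _ fun i _ => ?_)
    (Nat.sub_lt hn one_pos)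
  exact (natDegree_C_mul_X_pow_le _ _).trans (by omega)

lemma toQuotient_eq_mk {n : ℕ} (lam : F) (c : Fin n → F) :
    toQuotient n lam c = AdjoinRoot.mk (X ^ n - C lam : F[X]) (wordPoly c) := by
  simp [toQuotient, wordPoly, Algebra.smul_def, AdjoinRoot.algebraMap_eq]

lemma mem_constacyclicCode_iff {n : ℕ} {lam : F} {g : F[X]} (hg : g ∣ X ^ n - C lam)
    {c : Fin n → F} : c ∈ constacyclicCode n lam g ↔ g ∣ wordPoly c := by
  rw [constacyclicCode, Submodule.mem_comap, Submodule.restrictScalars_mem, toQuotient_eq_mk,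
    Ideal.mem_span_singleton]
  refine ⟨?_, map_dvd _⟩
  rintro ⟨z, hz⟩
  obtain ⟨z, rfl⟩ := AdjoinRoot.mk_surjective z
  rw [← map_mul, AdjoinRoot.mk_eq_mk] at hz
  exact (dvd_sub_left (dvd_mul_right g z)).1 (hg.trans hz)

lemma finrank_codeOfCheck_le {n : ℕ} (hn : 0 < n) {lam : F} {h : F[X]} (hh : h ∣ X ^ n - C lam) :
    Module.finrank F (codeOfCheck n lam h) ≤ h.natDegree := by
  obtain ⟨g, hg⟩ := hh
  have hne : X ^ n - C lam ≠ 0 := X_pow_sub_C_ne_zero hn lam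
  have hh0 : h ≠ 0 := left_ne_zero_of_mul (hg ▸ hne)
  have hg0 : g ≠ 0 := right_ne_zero_of_mul (hg ▸ hne)
  have hdeg : h.natDegree + g.natDegree = n := by
    rw [← natDegree_mul hh0 hg0, ← hg, natDegree_X_pow_sub_C]
  have hdiv : (X ^ n - C lam) / h = g := by rw [hg, mul_div_cancel_left₀ _ hh0]
  let Φ : F[X] →ₗ[F] (Fin n → F) :=
    LinearMap.pi fun i => lcoeff F (i : ℕ) ∘ₗ LinearMap.mulLeft F g
  have hle : codeOfCheck n lam h ≤ (degreeLT F h.natDegree).map Φ := by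
    intro c hc
    rw [codeOfCheck, hdiv, mem_constacyclicCode_iff ⟨h, by rw [hg, mul_comm]⟩] at hc
    obtain ⟨w, hw⟩ := hc
    refine ⟨w, ?_, ?_⟩
    · rcases eq_or_ne w 0 with rfl | hw0
      · exact Submodule.zero_mem _
      · have := natDegree_wordPoly_lt hn c
        rw [hw, natDegree_mul hg0 hw0] at this
        exact mem_degreeLT.2 ((natDegree_lt_iff_degree_lt hw0).1 (by omega))
    · ext i
      simp only [Φ, LinearMap.pi_apply, LinearMap.comp_apply, LinearMap.mulLeft_apply,
        lcoeff_apply]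
      rw [← hw, coeff_wordPoly]
  have hfin : Module.finrank F (degreeLT F h.natDegree) = h.natDegree := by
    rw [(degreeLTEquiv F h.natDegree).finrank_eq]
    simp
  have : Module.Finite F (degreeLT F h.natDegree) :=
    Module.Finite.equiv (degreeLTEquiv F h.natDegree).symm
  calc _ ≤ _ := Submodule.finrank_mono hle
    _ ≤ _ := Submodule.finrank_map_le _ _
    _ = _ := hfin

/-- Up to a unit the geometric sum is `(X ^ n - μ) / (X - γ)`, and `H` supplies the missing factor
`X - γ`. -/
lemma X_pow_sub_C_dvd_mul_geom_sum {n : ℕ} {γ μ : K} (hγ : γ ≠ 0) (hμ : γ ^ n = μ) {H : K[X]}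
    (hH : H.eval γ = 0) : X ^ n - C μ ∣ H * ∑ i : Fin n, C (γ⁻¹ ^ (i : ℕ)) * X ^ (i : ℕ) := by
  obtain ⟨H, rfl⟩ := dvd_iff_isRoot.2 hH
  have h1 : ∑ i : Fin n, C (γ⁻¹ ^ (i : ℕ)) * X ^ (i : ℕ) =
      ∑ i ∈ Finset.range n, (C γ⁻¹ * X) ^ i := by
    rw [Finset.sum_range]
    simp only [mul_pow, C_pow]
  have h2 : (X - C γ : K[X]) = C γ * (C γ⁻¹ * X - 1) := by
    rw [mul_sub, ← mul_assoc, ← C_mul, mul_inv_cancel₀ hγ]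
    simp
  have h3 : (C γ⁻¹ * X : K[X]) ^ n - 1 = C (μ⁻¹) * (X ^ n - C μ) := by
    rw [mul_sub, ← C_mul, ← hμ, inv_mul_cancel₀ (pow_ne_zero n hγ), mul_pow, ← C_pow, inv_pow]
    simp
  refine ⟨H * (C γ * C μ⁻¹), ?_⟩
  rw [h1, h2]
  have h4 := mul_geom_sum (C γ⁻¹ * X : K[X]) n
  rw [h3] at h4
  linear_combination (C γ * H) * h4

variable [Finite K]

lemma range_traceWord_le_codeOfCheck {n : ℕ} (hn : 0 < n) {lam : F} (hlam : lam ≠ 0) {x y : K}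
    (hx : x ^ n = algebraMap F K lam) (hy : y ^ n = algebraMap F K lam) {h : F[X]}
    (hh : h ∣ X ^ n - C lam) (hhx : aeval x h = 0) (hhy : aeval y h = 0) :
    LinearMap.range (traceWord F n x⁻¹ y⁻¹) ≤ codeOfCheck n lam h := by
  have : Finite F := Finite.of_injective _ (algebraMap F K).injective
  obtain ⟨g, hg⟩ := hh
  have hne : X ^ n - C lam ≠ 0 := X_pow_sub_C_ne_zero hn lam
  have hh0 : h ≠ 0 := left_ne_zero_of_mul (hg ▸ hne)
  have hdiv : (X ^ n - C lam) / h = g := by rw [hg, mul_div_cancel_left₀ _ hh0]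
  rintro _ ⟨⟨a, b⟩, rfl⟩
  rw [codeOfCheck, hdiv, mem_constacyclicCode_iff ⟨h, by rw [hg, mul_comm]⟩,
    ← mul_dvd_mul_iff_left hh0, ← hg, ← map_dvd_map' (algebraMap F K)]
  -- Over `K` the trace is a sum over the Galois group, which splits the word polynomial into
  -- geometric sums at the conjugates of `x` and `y`.
  have hw : (wordPoly (traceWord F n x⁻¹ y⁻¹ (a, b))).map (algebraMap F K) =
      ∑ σ : Gal(K/F), (C (σ a) * ∑ i : Fin n, C ((σ x)⁻¹ ^ (i : ℕ)) * X ^ (i : ℕ) +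
        C (σ b) * ∑ i : Fin n, C ((σ y)⁻¹ ^ (i : ℕ)) * X ^ (i : ℕ)) := by
    simp only [wordPoly, Polynomial.map_sum, Polynomial.map_mul, map_C, Polynomial.map_pow, map_X,
      traceWord_apply, trace_eq_sum_automorphisms, Finset.mul_sum, ← Finset.sum_add_distrib]
    rw [Finset.sum_comm]
    refine Finset.sum_congr rfl fun i _ => ?_
    rw [map_sum, Finset.sum_mul]
    refine Finset.sum_congr rfl fun σ _ => ?_
    simp only [map_add, map_mul, map_pow, map_inv₀]
    ring
  have hroot : ∀ (σ : Gal(K/F)) (z : K), z ^ n = algebraMap F K lam → aeval z h = 0 →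
      (X ^ n - C (algebraMap F K lam)) ∣
        h.map (algebraMap F K) * ∑ i : Fin n, C ((σ z)⁻¹ ^ (i : ℕ)) * X ^ (i : ℕ) := by
    intro σ z hz hz0
    refine X_pow_sub_C_dvd_mul_geom_sum ?_ ?_ ?_
    · intro h0
      have : z = 0 := by simpa using h0
      rw [this, zero_pow hn.ne'] at hz
      exact hlam (by simpa using hz.symm)
    · rw [← map_pow, hz, AlgEquiv.commutes]
    · rw [eval_map_algebraMap, aeval_algHom_apply σ z h, hz0, map_zero]
  rw [Polynomial.map_mul, hw, Finset.mul_sum]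
  simp only [Polynomial.map_sub, Polynomial.map_pow, map_X, map_C]
  refine Finset.dvd_sum fun σ _ => ?_
  rw [mul_add, mul_left_comm, mul_left_comm _ (C (σ b))]
  exact dvd_add (Dvd.dvd.mul_left (hroot σ x hx hhx) _) (Dvd.dvd.mul_left (hroot σ y hy hhy) _)

/-- The constacyclic code with check polynomial `minpoly x * minpoly y` consists of the
words `(Tr (a x⁻ⁱ + b y⁻ⁱ))ᵢ`. -/
lemma codeOfCheck_minpoly_mul_minpoly {n : ℕ} (hn : 0 < n) {lam : F} (hlam : lam ≠ 0) {x y : K}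
    (hx : x ^ n = algebraMap F K lam) (hy : y ^ n = algebraMap F K lam)
    (hinj : Function.Injective (traceWord F n x⁻¹ y⁻¹)) :
    codeOfCheck n lam (minpoly F x * minpoly F y) = LinearMap.range (traceWord F n x⁻¹ y⁻¹) := by
  have : Finite F := Finite.of_injective _ (algebraMap F K).injective
  have hintx : IsIntegral F x := Algebra.IsIntegral.isIntegral x
  have hinty : IsIntegral F y := Algebra.IsIntegral.isIntegral y
  have hcop : IsCoprime (minpoly F x) (minpoly F y) := by
    refine (Irreducible.coprime_iff_not_dvd (minpoly.irreducible hintx)).2 fun hdvd => ?_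
    have heq : minpoly F x = minpoly F y := eq_of_monic_of_associated (minpoly.monic hintx)
      (minpoly.monic hinty) ((minpoly.irreducible hintx).associated_of_dvd
        (minpoly.irreducible hinty) hdvd)
    obtain ⟨σ, hσ⟩ := isConjRoot_iff_exists_algEquiv.1 heq
    -- If `x` and `y` were conjugate, their powers would have equal traces, against injectivity.
    have h0 : traceWord F n x⁻¹ y⁻¹ (1, -1) = 0 := by
      ext i
      have : x⁻¹ ^ (i : ℕ) = σ (y⁻¹ ^ (i : ℕ)) := by rw [map_pow, map_inv₀, hσ]
      rw [traceWord_apply, one_mul, map_add, this, Algebra.trace_eq_of_algEquiv, ← map_add]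
      simp
    have := hinj (h0.trans (map_zero _).symm)
    simp at this
  have hroot : ∀ z : K, z ^ n = algebraMap F K lam → minpoly F z ∣ X ^ n - C lam := fun z hz =>
    minpoly.dvd F z (by simp [hz])
  have hdvd := hcop.mul_dvd (hroot x hx) (hroot y hy)
  refine (Submodule.eq_of_le_of_finrank_le (range_traceWord_le_codeOfCheck hn hlam hx hy hdvd
    (by simp) (by simp)) ?_).symm
  refine (finrank_codeOfCheck_le hn hdvd).trans ?_
  rw [LinearMap.finrank_range_of_inj hinj, Module.finrank_prod]
  exact natDegree_mul_le.trans (add_le_add (minpoly.natDegree_le x) (minpoly.natDegree_le y))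

end TraceCode

/-! ### From section polynomials to ovoid codes -/

section Ovoid

variable {F K : Type*} [Field F] [DecidableEq F] [Field K] [Fintype K] [Algebra F K]

/-- A trace code whose words are, up to nonzero factors, the values of the section polynomials at
the `(q ^ 2 + 1)`-th roots of unity. -/
lemma traceWord_injective_and_isOvoidCode {p m q : ℕ} [Fact p.Prime] [CharP K p] (hq : q = p ^ m)
    (hq2 : 2 ≤ q) (hK : Fintype.card K = q ^ 4) (hFK : Module.finrank F K = 2) {x y θ : K}
    (hx : x ≠ 0) (hθ : IsPrimitiveRoot θ (q ^ 2 + 1)) {σ : K → K} (hσ : Function.Surjective σ)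
    (hσ0 : ∀ b, σ b = 0 → b = 0)
    (hval : ∀ a b (i : Fin (q ^ 2 + 1)),
      algebraMap F K (traceWord F (q ^ 2 + 1) x y (a, b) i) =
        x ^ (i : ℕ) * (sectionPoly q a (σ b)).eval (θ ^ (i : ℕ))) :
    Function.Injective (traceWord F (q ^ 2 + 1) x y) ∧
      IsOvoidCode q (LinearMap.range (traceWord F (q ^ 2 + 1) x y)) := by
  classical
  set V := traceWord F (q ^ 2 + 1) x y with hV
  set u : Fin (q ^ 2 + 1) → K := fun i => θ ^ (i : ℕ) with hu
  have huinj : Function.Injective u := fun i j hij => Fin.ext (hθ.pow_inj i.2 j.2 hij)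
  have hu1 : ∀ i, u i ^ (q ^ 2 + 1) = 1 := fun i => by
    rw [hu, ← pow_mul, mul_comm, pow_mul, hθ.pow_eq_one, one_pow]
  have hzero : ∀ a b i, V (a, b) i = 0 ↔ (sectionPoly q a (σ b)).eval (u i) = 0 := by
    intro a b i
    rw [← (algebraMap F K).injective.eq_iff, hval, map_zero, mul_eq_zero,
      or_iff_right (pow_ne_zero _ hx)]
  have hfilter : ∀ a b, (Finset.univ.filter fun i => V (a, b) i = 0) =
      Finset.univ.filter fun i => (sectionPoly q a (σ b)).eval (u i) = 0 := fun a b =>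
    Finset.filter_congr fun i _ => hzero a b i
  have hcard : ∀ ab : K × K, ab ≠ 0 →
      (Finset.univ.filter fun i => V ab i = 0).card ≤ q + 1 := by
    rintro ⟨a, b⟩ hab
    rw [hfilter]
    have hne : a ≠ 0 ∨ σ b ≠ 0 := by
      by_contra! h
      exact hab (by rw [h.1, hσ0 b h.2]; rfl)
    exact (card_filter_eval_eq_zero_le huinj (sectionPoly_ne_zero hq2 hne)).trans
      (natDegree_sectionPoly_le _ _ _)
  have hinj : Function.Injective V := by
    rw [← LinearMap.ker_eq_bot, LinearMap.ker_eq_bot']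
    intro ab h0
    by_contra hne
    -- The zero word has `q ^ 2 + 1 > q + 1` zeros.
    have := hcard ab hne
    simp [h0] at this
    nlinarith
  refine ⟨hinj, ?_, ?_, ?_, ?_⟩
  · rw [LinearMap.finrank_range_of_inj hinj, Module.finrank_prod, hFK]
  · rintro _ ⟨ab, rfl⟩ hne
    exact hcard ab fun h => hne (by rw [h, map_zero])
  · intro i
    obtain ⟨a, b', ha, hdvd, hne⟩ := exists_sectionPoly_dvd_eval_ne_zero p m hq hq2 hK (u i)
    obtain ⟨b, rfl⟩ := hσ b'
    refine ⟨_, ⟨(a, b), rfl⟩, fun h => hne ((hzero a b i).1 h), ?_⟩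
    rw [hfilter, ← natDegree_sectionPoly (show q ≠ 0 by omega) ha (σ b)]
    refine natDegree_le_card_filter_of_dvd huinj
      (g := X ^ (q ^ 2 + 1) - 1) (X_pow_sub_C_ne_zero (by omega) 1) ?_ (fun i => ?_) hdvd
    · rw [Fintype.card_fin, ← C_1, natDegree_X_pow_sub_C]
    · simp [hu1]
  · intro i j k hki hkj
    obtain ⟨a, b', c, hc, heval⟩ := exists_sectionPoly_secant hq2 hK
      (fun x y => by rw [hq, add_pow_char_pow]) (hu1 i) (hu1 j)
    obtain ⟨b, rfl⟩ := hσ b'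
    refine ⟨_, ⟨(a, b), rfl⟩, (hzero a b i).2 (by simp [heval]), (hzero a b j).2 (by simp [heval]),
      fun h => ?_⟩
    rw [hzero, heval] at h
    simp only [mul_eq_zero, hc, false_or, sub_eq_zero, huinj.eq_iff, hki] at h
    have hinjq : Function.Injective fun z : K => z ^ q := by
      rw [hq]
      exact iterateFrobenius_inj K p m
    exact hkj (huinj (hinjq h))

end Ovoid

/-! ### Arithmetic behind the primitive root of unity -/

lemma odd_of_padicValNat_mul_eq {r e : ℕ} (hr : r ≠ 0) (he : e ≠ 0)
    (h : padicValNat 2 r = padicValNat 2 (r * e)) : Odd e := by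
  rw [padicValNat.mul hr he] at h
  rw [← Nat.not_even_iff_odd, even_iff_two_dvd]
  intro h2
  have := one_le_padicValNat_of_dvd he h2
  omega

/-- An odd common divisor of `q ± 1` and `q ^ 2 + 1` is trivial. -/
lemma coprime_sq_add_one {e q : ℕ} (he : Odd e) (h : (e : ℤ) ∣ (q : ℤ) ^ 2 - 1) :
    e.Coprime (q ^ 2 + 1) := by
  have h1 : ((e.gcd (q ^ 2 + 1) : ℕ) : ℤ) ∣ 2 := by
    have h2 : ((e.gcd (q ^ 2 + 1) : ℕ) : ℤ) ∣ (q : ℤ) ^ 2 + 1 := by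
      exact_mod_cast Int.natCast_dvd_natCast.2 (Nat.gcd_dvd_right e (q ^ 2 + 1))
    have h3 : ((e.gcd (q ^ 2 + 1) : ℕ) : ℤ) ∣ (q : ℤ) ^ 2 - 1 :=
      (Int.natCast_dvd_natCast.2 (Nat.gcd_dvd_left e _)).trans h
    exact (dvd_sub h2 h3).trans (dvd_of_eq (by ring))
  have h4 : e.gcd (q ^ 2 + 1) ∣ 2 := by exact_mod_cast h1
  exact Nat.Coprime.eq_one_of_dvd
    ((Nat.coprime_two_right.2 he).coprime_dvd_left (Nat.gcd_dvd_left _ _)) h4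

lemma isPrimitiveRoot_pow_mul {K : Type*} [Field K] {x : K} {r n e : ℕ} (hrn : 0 < r * n)
    (hx : IsPrimitiveRoot x (r * n)) (he : e.Coprime n) : IsPrimitiveRoot (x ^ (r * e)) n := by
  rw [pow_mul]
  exact (hx.pow hrn rfl).pow_of_coprime e he

/-! ### The two families of codes -/

section Main

variable {F K : Type*} [Field F] [Fintype F] [Field K] [Fintype K] [Algebra F K]

lemma algebraMap_traceWord {q : ℕ} (hF : Fintype.card F = q ^ 2) (hFK : Module.finrank F K = 2)
    {n : ℕ} (x y a b : K) (i : Fin n) (hadd : ∀ x y : K, (x + y) ^ q ^ 2 = x ^ q ^ 2 + y ^ q ^ 2) :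
    algebraMap F K (traceWord F n x y (a, b) i) =
      a * x ^ (i : ℕ) + b * y ^ (i : ℕ) + a ^ q ^ 2 * (x ^ (i : ℕ)) ^ q ^ 2 +
        b ^ q ^ 2 * (y ^ (i : ℕ)) ^ q ^ 2 := by
  rw [traceWord_apply, FiniteField.algebraMap_trace_eq_sum_pow, hFK, Nat.card_eq_fintype_card, hF]
  simp only [Finset.sum_range_succ, Finset.sum_range_zero, pow_zero, pow_one, hadd, mul_pow]
  ring

lemma codeC_isOvoidCode [DecidableEq F] (p m q r s : ℕ) (hp : p.Prime) (hm : 0 < m)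
    (hq : q = p ^ m) (hF : Fintype.card F = q ^ 2) (hK : Fintype.card K = q ^ 4)
    (lam : Fˣ) (hr : orderOf lam = r)
    (δ : K) (hδ : IsPrimitiveRoot δ (r * (q ^ 2 + 1)))
    (hδn : δ ^ (q ^ 2 + 1) = algebraMap F K (lam : F))
    (hs : (r ∣ q + 1 ∧ padicValNat 2 r = padicValNat 2 (q + 1) ∧ s = q ^ 2 + q + 1) ∨
      (r ∣ q - 1 ∧ padicValNat 2 r = padicValNat 2 (q - 1) ∧ s = q ^ 2 - q + 1)) :
    IsOvoidCode q (codeC q (lam : F) δ s) := by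
  have : Fact p.Prime := ⟨hp⟩
  have hq2 : 2 ≤ q := hq ▸ hp.two_le.trans (Nat.le_self_pow hm.ne' p)
  have hchar : CharP K p := by
    have hcard : Fintype.card K = p ^ (m * 4) := by rw [hK, hq, pow_mul]
    exact charP_of_card_eq_prime_pow hcard
  have hFK : Module.finrank F K = 2 := by
    have h := Module.card_eq_pow_finrank (K := F) (V := K)
    rw [hF, hK, ← pow_mul] at h
    have := Nat.pow_right_injective hq2 h
    omega
  have hadd : ∀ x y : K, (x + y) ^ q ^ 2 = x ^ q ^ 2 + y ^ q ^ 2 := fun x y => by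
    rw [hq, ← pow_mul, add_pow_char_pow]
  have hr0 : 0 < r := hr ▸ orderOf_pos lam
  have hδ0 : δ ≠ 0 := hδ.ne_zero (by positivity)
  have hx0 : δ⁻¹ ≠ 0 := inv_ne_zero hδ0
  have hprim : IsPrimitiveRoot δ⁻¹ (r * (q ^ 2 + 1)) := hδ.inv
  have hrn : 0 < r * (q ^ 2 + 1) := by positivity
  have hfrob : ∀ z : K, z ^ q ^ 4 = z := fun z => by rw [← hK, FiniteField.pow_card]
  have hfrob2 : ∀ z : K, (z ^ q ^ 2) ^ q ^ 2 = z := fun z => by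
    rw [← pow_mul, ← pow_add, hfrob]
  suffices h : r ∣ s - 1 ∧ 1 ≤ s ∧
      Function.Injective (traceWord F (q ^ 2 + 1) δ⁻¹ (δ ^ s)⁻¹) ∧
      IsOvoidCode q (LinearMap.range (traceWord F (q ^ 2 + 1) δ⁻¹ (δ ^ s)⁻¹)) by
    obtain ⟨⟨t, ht⟩, hs1, hinj, hov⟩ := h
    -- From `r ∣ s - 1` it follows that `δ ^ s` is again an `n`-th root of `lam`.
    have hlam : (lam : F) ^ s = lam := by
      rw [show s = r * t + 1 by omega, pow_succ, pow_mul, ← Units.val_pow_eq_pow_val lam r, ← hr,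
        pow_orderOf_eq_one]
      simp
    rw [codeC, codeOfCheck_minpoly_mul_minpoly (by omega) lam.ne_zero hδn _ hinj]
    · exact hov
    · rw [← pow_mul, mul_comm, pow_mul, hδn, ← map_pow, hlam]
  have hone : ∀ (i k : ℕ), r ∣ k → ((δ⁻¹) ^ i) ^ ((q ^ 2 + 1) * k) = 1 := by
    rintro i _ ⟨k, rfl⟩
    rw [← pow_mul, show i * ((q ^ 2 + 1) * (r * k)) = r * (q ^ 2 + 1) * (i * k) by ring, pow_mul,
      hprim.pow_eq_one, one_pow]
  rcases hs with ⟨hrq, hv, rfl⟩ | ⟨hrq, hv, rfl⟩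
  · obtain ⟨e, he⟩ := id hrq
    refine ⟨?_, by omega, ?_⟩
    · exact (show r ∣ q * (q + 1) from hrq.mul_left q).trans
        (dvd_of_eq (by rw [Nat.add_sub_cancel]; ring))
    have he0 : e ≠ 0 := by
      rintro rfl
      omega
    have hodd : Odd e := odd_of_padicValNat_mul_eq hr0.ne' he0 (by rw [hv, he])
    have hcop : (q * e).Coprime (q ^ 2 + 1) := by
      refine Nat.Coprime.mul_left ?_ (coprime_sq_add_one hodd ?_)
      · rw [sq]; simp
      · refine (show (e : ℤ) ∣ (q : ℤ) + 1 from ?_).trans ⟨(q : ℤ) - 1, by ring⟩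
        exact_mod_cast (Int.natCast_dvd_natCast.2 (he ▸ Nat.dvd_mul_left e r))
    -- With `β = δ⁻ⁱ` and `u = β ^ (q ^ 2 + q)`, one has `β ^ s = β u`. The exponent is `r * (q *
    -- e)` where `r * e = q + 1`.
    refine traceWord_injective_and_isOvoidCode hq hq2 hK hFK hx0
      (isPrimitiveRoot_pow_mul hrn hprim hcop) (σ := id) Function.surjective_id (fun b h => h) ?_
    intro a b i
    rw [algebraMap_traceWord hF hFK _ _ _ _ _ hadd, eval_sectionPoly, ← inv_pow,
      show r * (q * e) = q ^ 2 + q by rw [mul_left_comm, ← he]; ring,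
      ← pow_mul δ⁻¹ _ (i : ℕ), ← pow_mul δ⁻¹ _ (i : ℕ), mul_comm _ (i : ℕ), mul_comm _ (i : ℕ),
      pow_mul, pow_mul, id]
    have h1 := hone i (q + 1) hrq
    have h4 := hfrob (δ⁻¹ ^ (i : ℕ))
    generalize δ⁻¹ ^ (i : ℕ) = β at h1 h4 ⊢
    have e1 : (β ^ (q ^ 2 + q)) ^ (q + 1) * β = β ^ q ^ 2 := by
      rw [← pow_mul, ← pow_succ, show (q ^ 2 + q) * (q + 1) + 1 =
        q ^ 2 + (q ^ 2 + 1) * (q + 1) by ring, pow_add, h1, mul_one]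
    have e2 : (β ^ (q ^ 2 + q + 1)) ^ q ^ 2 = (β ^ (q ^ 2 + q)) ^ q * β := by
      rw [← pow_mul, ← pow_mul, show (q ^ 2 + q + 1) * q ^ 2 = q ^ 4 + (q ^ 2 + q) * q by ring,
        pow_add, h4, mul_comm]
    rw [e2, ← e1]
    ring
  · obtain ⟨e, he⟩ := id hrq
    obtain ⟨k, rfl⟩ : ∃ k, q = k + 1 := ⟨q - 1, by omega⟩
    rw [Nat.add_sub_cancel] at he hv hrq
    have hs : (k + 1) ^ 2 - (k + 1) + 1 = (k + 1) * k + 1 := by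
      rw [show (k + 1) ^ 2 = (k + 1) * k + (k + 1) by ring, Nat.add_sub_cancel]
    rw [hs]
    refine ⟨by simpa using hrq.mul_left (k + 1), by omega, ?_⟩
    have he0 : e ≠ 0 := by
      rintro rfl
      omega
    have hodd : Odd e := odd_of_padicValNat_mul_eq hr0.ne' he0 (by rw [hv, he])
    have hcop : e.Coprime ((k + 1) ^ 2 + 1) := by
      refine coprime_sq_add_one hodd ?_
      refine (Int.natCast_dvd_natCast.2 (he ▸ Nat.dvd_mul_left e r : e ∣ k)).trans ?_
      exact ⟨(k : ℤ) + 2, by push_cast; ring⟩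
    -- Now `u = β ^ (q - 1)` and `β ^ s = β u ^ q`, so `b` sits at `u ^ q` and its conjugate at `u`;
    -- hence the twist `σ`.
    refine traceWord_injective_and_isOvoidCode hq hq2 hK hFK hx0
      (isPrimitiveRoot_pow_mul hrn hprim hcop) (σ := fun b => b ^ (k + 1) ^ 2)
      (fun b => ⟨_, hfrob2 b⟩) (fun b h => pow_eq_zero_iff (by positivity) |>.1 h) ?_
    intro a b i
    rw [algebraMap_traceWord hF hFK _ _ _ _ _ hadd, eval_sectionPoly, ← inv_pow, ← he,
      ← pow_mul δ⁻¹ _ (i : ℕ), ← pow_mul δ⁻¹ _ (i : ℕ), mul_comm _ (i : ℕ), mul_comm _ (i : ℕ),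
      pow_mul, pow_mul, hfrob2]
    have h1 := hone i k hrq
    have h4 := hfrob (δ⁻¹ ^ (i : ℕ))
    have hβ : δ⁻¹ ^ (i : ℕ) ≠ 0 := pow_ne_zero _ hx0
    generalize δ⁻¹ ^ (i : ℕ) = β at h1 h4 hβ ⊢
    have e1 : (β ^ k) ^ (k + 1 + 1) * β = β ^ (k + 1) ^ 2 := by
      rw [← pow_mul, ← pow_succ]; congr 1; ring
    have e2 : (β ^ ((k + 1) * k + 1)) ^ (k + 1) ^ 2 = β ^ k * β := by
      refine mul_right_cancel₀ hβ ?_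
      rw [← mul_one ((β ^ ((k + 1) * k + 1)) ^ (k + 1) ^ 2), ← h1, ← pow_mul, ← pow_add,
        ← pow_succ, show ((k + 1) * k + 1) * (k + 1) ^ 2 + ((k + 1) ^ 2 + 1) * k + 1 =
          (k + 1) ^ 4 + (k + 1) by ring, pow_add, h4, pow_succ, mul_comm]
    have e3 : β ^ ((k + 1) * k + 1) = (β ^ k) ^ (k + 1) * β := by
      rw [← pow_mul, ← pow_succ]; congr 1; ring
    rw [e2, e3, ← e1]
    ring

end Main

end LRCCode

theorem mainTheorem5 {F K : Type*} [Field F] [Fintype F] [DecidableEq F] [Field K] [Fintype K]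
    [Algebra F K] (p m q r s : ℕ) (hp : p.Prime) (hm : 0 < m) (hq : q = p ^ m)
    (hF : Fintype.card F = q ^ 2) (hK : Fintype.card K = q ^ 4)
    (lam : Fˣ) (hr : orderOf lam = r)
    (δ : K) (hδ : IsPrimitiveRoot δ (r * (q ^ 2 + 1)))
    (hδn : δ ^ (q ^ 2 + 1) = algebraMap F K (lam : F))
    (hs : (r ∣ q + 1 ∧ padicValNat 2 r = padicValNat 2 (q + 1) ∧ s = q ^ 2 + q + 1) ∨
      (r ∣ q - 1 ∧ padicValNat 2 r = padicValNat 2 (q - 1) ∧ s = q ^ 2 - q + 1)) :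
    IsLeast {l | LRCCode.HasLocality (LRCCode.dual (LRCCode.codeC q (lam : F) δ s)) l}
      (q ^ 2 - q - 1) ∧
    LRCCode.IsDistanceOptimalLRC (LRCCode.dual (LRCCode.codeC q (lam : F) δ s))
      (q ^ 2 - 3) (if q = 2 then 5 else 4) (q ^ 2 - q - 1) ∧
    LRCCode.IsDimensionOptimalLRC (LRCCode.dual (LRCCode.codeC q (lam : F) δ s))
      (q ^ 2 - 3) (if q = 2 then 5 else 4) (q ^ 2 - q - 1) := by
  have hW := LRCCode.codeC_isOvoidCode p m q r s hp hm hq hF hK lam hr δ hδ hδn hs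
  have hq2 : 2 ≤ q := hq ▸ hp.two_le.trans (Nat.le_self_pow hm.ne' p)
  exact ⟨⟨hW.hasLocality_dual, fun l hl => hW.le_of_hasLocality_dual hl⟩,
    hW.isDistanceOptimalLRC_dual hq2, hW.isDimensionOptimalLRC_dual hF hq2⟩
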